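/- Let $\mathcal{E}$ be an elementary topos (a category with finite limits, exponentials and a subobject classifier $\Omega$). A geometric morphism $p : \mathcal{E} \to \mathcal{S}$ to an elementary topos $\mathcal{S}$, given by $p^* \dashv p_*$ with $p^*$ preserving finite limits, is called hyperconnected if $p^*$ is fully faithful and the counit $\beta_X : p^*p_*X \to X$ is monic for every object $X$ of $\mathcal{E}$. Identify $p : \mathcal{E} \to \mathcal{S}$ with $q : \mathcal{E} \to \mathcal{S}'$ when there is an equivalence $e : \mathcal{S} \simeq \mathcal{S}'$ with $q^* \circ e \cong p^*$. A Lawvere–Tierney topology on $\mathcal{E}$ is a map $j : \Omega \to \Omega$ with $j \circ \mathrm{true} = \mathrm{true}$, $j \circ j = j$ and $j \circ \wedge = \wedge \circ (j \times j)$; the associated universal closure operator sends a subobject $U$ of $X$ with characteristic map $\chi_U$ to the subobject of $X$ classified by $j \circ \chi_U$. Then the hyperconnected geometric morphisms with domain $\mathcal{E}$ whose direct image functor $p_*$ preserves epimorphisms are, up to the above identification, no more numerous than the Lawvere–Tierney topologies on $\mathcal{E}$. More precisely, there is an injective map from the class of such morphisms, up to this identification, to the Lawvere–Tierney topologies on $\mathcal{E}$,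 which sends $p$ to the topology whose closure operator takes every subobject $U$ of every object $X$ to the Heyting implication $(\beta_X \Rightarrow U)$ in the lattice of subobjects of $X$. -/

import Mathlib

open CategoryTheory CategoryTheory.Limits

universe u' v' u v

noncomputable section

namespace HyperFew

/-- An elementary topos: a category with finite limits and a subobject classifier in which every
functor `A × -` has a right adjoint. -/
class ElementaryTopos (E : Type u) [Category.{v} E] : Prop extends
    HasFiniteLimits E, HasSubobjectClassifier E where
  exponentiable : ∀ A : E, (prod.functor.obj A).IsLeftAdjoint

/-- A geometric morphism `E ⟶ S`: an adjunction `p^* ⊣ p_*` with `p_* : E ⥤ S` the direct image and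
`p^* : S ⥤ E` the inverse image, such that `p^*` preserves finite limits. -/
structure GeometricMorphism (E : Type u) [Category.{v} E] (S : Type u') [Category.{v'} S] where
  directImage : E ⥤ S
  inverseImage : S ⥤ E
  adj : inverseImage ⊣ directImage
  preservesFiniteLimits : PreservesFiniteLimits inverseImage

/-- A geometric morphism is hyperconnected if its inverse image functor is fully faithful and the
counit `p^* p_* X ⟶ X` is a monomorphism for every `X`. -/
structure GeometricMorphism.IsHyperconnected {E : Type u} [Category.{v} E] {S : Type u'}
    [Category.{v'} S] (p : GeometricMorphism E S) : Prop where
  full : p.inverseImage.Full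
  faithful : p.inverseImage.Faithful
  mono_counit : ∀ X : E, Mono (p.adj.counit.app X)

/-- A hyperconnected geometric morphism out of `E`, into some elementary topos, whose direct image
functor preserves epimorphisms. -/
structure GoodHyperconnected (E : Type u) [Category.{v} E] where
  codomain : Type u'
  [category : Category.{v'} codomain]
  [topos : ElementaryTopos codomain]
  morphism : GeometricMorphism E codomain
  isHyperconnected : morphism.IsHyperconnected
  preservesEpimorphisms : morphism.directImage.PreservesEpimorphisms

attribute [instance] GoodHyperconnected.category GoodHyperconnected.topos

namespace GoodHyperconnected

variable {E : Type u} [Category.{v} E]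

/-- The subobject `β_X : p^* p_* X ⟶ X` of `X` given by the counit. -/
def core (p : GoodHyperconnected.{u', v'} E) (X : E) : Subobject X :=
  haveI := p.isHyperconnected.mono_counit X
  Subobject.mk (p.morphism.adj.counit.app X)

/-- Geometric morphisms `p : E ⟶ S` and `q : E ⟶ S'` are identified if there is an equivalence
`e : S ≌ S'` compatible, up to natural isomorphism, with the inverse image functors. -/
def Equivalent (p q : GoodHyperconnected.{u', v'} E) : Prop :=
  ∃ e : p.codomain ≌ q.codomain,
    Nonempty (e.functor ⋙ q.morphism.inverseImage ≅ p.morphism.inverseImage)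

variable (E) in
/-- The setoid of equivalence of geometric morphisms under `E`. -/
instance setoid : Setoid (GoodHyperconnected.{u', v'} E) where
  r := Equivalent
  iseqv :=
    { refl := fun p => ⟨CategoryTheory.Equivalence.refl, ⟨Functor.leftUnitor _⟩⟩
      symm := by
        rintro p q ⟨e, ⟨i⟩⟩
        exact ⟨e.symm, ⟨Functor.isoWhiskerLeft e.inverse i.symm ≪≫
          (Functor.associator _ _ _).symm ≪≫
          Functor.isoWhiskerRight e.counitIso q.morphism.inverseImage ≪≫
          Functor.leftUnitor _⟩⟩
      trans := by
        rintro p q r ⟨e, ⟨i⟩⟩ ⟨f, ⟨k⟩⟩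
        exact ⟨e.trans f, ⟨Functor.associator _ _ _ ≪≫
          Functor.isoWhiskerLeft e.functor k ≪≫ i⟩⟩ }

end GoodHyperconnected

section LawvereTierney

variable (E : Type u) [Category.{v} E] [ElementaryTopos E]

open HasSubobjectClassifier

/-- The internal conjunction `Ω × Ω ⟶ Ω`: the characteristic map of `⟨true, true⟩`. -/
def meet : Ω E ⨯ Ω E ⟶ Ω E :=
  χ (prod.lift (truth E) (truth E))

/-- A Lawvere–Tierney topology: an endomorphism `j` of `Ω` with `j ∘ true = true`, `j ∘ j = j` and
`j ∘ ∧ = ∧ ∘ (j × j)`. -/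
@[ext]
structure LawvereTierneyTopology where
  j : Ω E ⟶ Ω E
  truth_comp : truth E ≫ j = truth E
  comp_self : j ≫ j = j
  meet_comp : meet E ≫ j = prod.map j j ≫ meet E

variable {E}

/-- The closure of a subobject `U` of `X` for the universal closure operator of a Lawvere–Tierney
topology `j`: the subobject of `X` classified by `j ∘ χ_U`. -/
def LawvereTierneyTopology.closure (J : LawvereTierneyTopology E) {X : E} (U : Subobject X) :
    Subobject X :=
  (Subobject.pullback (χ U.arrow ≫ J.j)).obj (Subobject.mk (truth E))

end LawvereTierney

/-- `W` is the Heyting implication `A ⇒ U` in the poset of subobjects of `X`. -/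
def IsHeytingImplication {E : Type u} [Category.{v} E] [HasPullbacks E] {X : E}
    (A U W : Subobject X) : Prop :=
  ∀ V : Subobject X, V ≤ W ↔ V ⊓ A ≤ U

end HyperFew

end

namespace HyperFew

open HasSubobjectClassifier Subobject

/-! Call the subobject `β_X` the core of `X`. Cores are functorial, and the core of a subobject `V`
of `X` is `V ⊓ core X`, because `p^* p_*` preserves the pullback square that classifies `V`
(`core_factors_of_comp_mono`). The crux is `factors_of_factors_core`, where preservation of
epimorphisms by `p_*` enters: a property of a map landing in a core may be tested on the core of its
domain. Hence `core Ω ⇒ true` is classified by a map `j` such that `φ ≫ j` is true exactly when `φ`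
is true on the core of its domain. The topology axioms and the formula for closure follow from this.
For injectivity, `core X` is the least `U` with `(core X ⇒ U) = ⊤`, so the topology determines all
cores. The cores determine `p`, since `p^*` identifies the codomain with the full subcategory of
objects equal to their core. -/

/-- Subobjects are determined by their generalized elements. -/
lemma subobject_ext {C : Type u} [Category.{v} C] {X : C} {U V : Subobject X}
    (H : ∀ {W : C} (h : W ⟶ X), U.Factors h ↔ V.Factors h) : U = V :=
  le_antisymm (le_of_factors ((H _).1 (factors_self U))) (le_of_factors ((H _).2 (factors_self V)))

/-! ### Images, implication and conjunction in an elementary topos -/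

section Topos

variable {E : Type u} [Category.{v} E] [ElementaryTopos E]

variable (E) in
/-- The subobject `true` of `Ω`. -/
noncomputable abbrev trueSubobject : Subobject (Ω E) := Subobject.mk (truth E)

lemma pullback_χ_trueSubobject {X : E} (U : Subobject X) :
    (Subobject.pullback (χ U.arrow)).obj (trueSubobject E) = U := by
  have := Subobject.Classifier.pullback_χ_obj_mk_truth
    (HasSubobjectClassifier.exists_classifier (C := E)).some U.arrow
  rwa [Subobject.mk_arrow] at this

lemma trueSubobject_factors_comp_χ {W X : E} (h : W ⟶ X) (U : Subobject X) :
    (trueSubobject E).Factors (h ≫ χ U.arrow) ↔ U.Factors h := by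
  rw [← pullback_factors_iff, pullback_χ_trueSubobject]

/-- Maps into `Ω` are determined by the generalized elements at which they are true. -/
lemma Ω_hom_ext {X : E} {φ ψ : X ⟶ Ω E}
    (H : ∀ {W : E} (h : W ⟶ X),
      (trueSubobject E).Factors (h ≫ φ) ↔ (trueSubobject E).Factors (h ≫ ψ)) : φ = ψ := by
  apply (Subobject.Classifier.representableBy
    (HasSubobjectClassifier.exists_classifier (C := E)).some).homEquiv.injective
  refine subobject_ext fun h => ?_
  exact (pullback_factors_iff φ _ h).trans ((H h).trans (pullback_factors_iff ψ _ h).symm)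

/-- Turns membership into an equation between maps to `Ω`, which can be transposed along the
exponential adjunction. -/
lemma comp_χ_eq_comp_χ_top_iff {W X : E} (h : W ⟶ X) (U : Subobject X) :
    h ≫ χ U.arrow = h ≫ χ (⊤ : Subobject X).arrow ↔ U.Factors h := by
  constructor
  · intro e
    rw [← trueSubobject_factors_comp_χ, e, trueSubobject_factors_comp_χ]
    exact top_factors h
  · intro H
    refine Ω_hom_ext fun k => ?_
    rw [← Category.assoc, ← Category.assoc, trueSubobject_factors_comp_χ,
      trueSubobject_factors_comp_χ]
    exact ⟨fun _ => top_factors _, fun _ => factors_of_factors_right _ H⟩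

/-- Universal quantification along a product projection. -/
lemma exists_forall_subobject {A B : E} (S : Subobject (A ⨯ B)) :
    ∃ R : Subobject B, ∀ {W : E} (b : W ⟶ B), R.Factors b ↔ S.Factors (prod.map (𝟙 A) b) := by
  have := ElementaryTopos.exponentiable A
  let adj := Adjunction.ofIsLeftAdjoint (prod.functor.obj A)
  let c (U : Subobject (A ⨯ B)) : (prod.functor.obj A).obj B ⟶ Ω E :=
    let c' := χ U.arrow
    c'
  refine ⟨equalizerSubobject (adj.homEquiv B (Ω E) (c S)) (adj.homEquiv B (Ω E) (c ⊤)),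
    fun b => ?_⟩
  rw [equalizerSubobject_factors_iff, ← adj.homEquiv_naturality_left,
    ← adj.homEquiv_naturality_left, (adj.homEquiv _ _).apply_eq_iff_eq]
  exact comp_χ_eq_comp_χ_top_iff (prod.map (𝟙 A) b) S

/-- Power objects, with their membership relation. -/
lemma exists_power_object (B : E) :
    ∃ (P : E) (M : Subobject (B ⨯ P)), ∀ {W : E} (U : Subobject (B ⨯ W)),
      ∃ s : W ⟶ P, (Subobject.pullback (prod.map (𝟙 B) s)).obj M = U := by
  have := ElementaryTopos.exponentiable B
  let adj := Adjunction.ofIsLeftAdjoint (prod.functor.obj B)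
  refine ⟨_, (Subobject.pullback (adj.counit.app (Ω E))).obj (trueSubobject E), fun {W} U => ?_⟩
  let c' := χ U.arrow
  let c : (prod.functor.obj B).obj W ⟶ Ω E := c'
  refine ⟨adj.homEquiv W (Ω E) c, ?_⟩
  have e : prod.map (𝟙 B) (adj.homEquiv W (Ω E) c) ≫ adj.counit.app (Ω E) = c :=
    (adj.homEquiv_counit (g := adj.homEquiv W (Ω E) c)).symm.trans
      ((adj.homEquiv W (Ω E)).symm_apply_apply c)
  refine Eq.trans ?_ (pullback_χ_trueSubobject U)
  refine ((Subobject.pullback_comp _ _ _).symm.trans ?_)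
  exact congrArg (fun φ => (Subobject.pullback φ).obj (trueSubobject E)) e

/-- Every map into an object of a topos factors through a smallest subobject. -/
lemma exists_smallest_factors {A B : E} (f : A ⟶ B) :
    ∃ I : Subobject B, I.Factors f ∧ ∀ U : Subobject B, U.Factors f → I ≤ U := by
  -- `T` consists of the names of subobjects of `B` through which `f` factors; `I` is the
  -- intersection of all members of `T`.
  obtain ⟨P, M, hM⟩ := exists_power_object B
  obtain ⟨T, hT⟩ := exists_forall_subobject ((Subobject.pullback (prod.map f (𝟙 P))).obj M)
  obtain ⟨I, hI⟩ := exists_forall_subobject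
    ((Subobject.pullback (prod.lift prod.snd (prod.fst ≫ T.arrow) : (T : E) ⨯ B ⟶ B ⨯ P)).obj M)
  have hT' : ∀ {W : E} (s : W ⟶ P), T.Factors s ↔ M.Factors (prod.map f s) := fun s => by
    rw [hT, pullback_factors_iff]; simp
  have hI' : ∀ {W : E} (b : W ⟶ B), I.Factors b ↔
      M.Factors (prod.lift (prod.snd ≫ b) (prod.fst ≫ T.arrow) : (T : E) ⨯ W ⟶ B ⨯ P) :=
    fun b => by rw [hI, pullback_factors_iff]; simp
  refine ⟨I, ?_, fun U hU => le_of_factors ?_⟩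
  · rw [hI']
    convert factors_of_factors_right (prod.lift prod.snd prod.fst) ((hT' _).1 (factors_self T))
      using 1
    simp
  -- `s` is the name of `U`, a global element of `P`. It lies in `T`, so instantiating the
  -- intersection at `s` gives `I ≤ U`.
  · obtain ⟨s, hs⟩ := hM ((Subobject.pullback (prod.fst : B ⨯ ⊤_ E ⟶ B)).obj U)
    have hMs : ∀ {W : E} (k : W ⟶ B ⨯ ⊤_ E),
        M.Factors (k ≫ prod.map (𝟙 B) s) ↔ U.Factors (k ≫ prod.fst) := fun k => by
      rw [← pullback_factors_iff, hs, pullback_factors_iff]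
    have hTs : T.Factors s := by
      have := (hMs (prod.map f (𝟙 (⊤_ E)))).2 (by
        rw [prod.map_fst]; exact factors_of_factors_right _ hU)
      rw [hT']
      simpa using this
    have h1 := factors_of_factors_right
      (prod.lift (terminal.from (I : E) ≫ T.factorThru s hTs) (𝟙 (I : E)))
      ((hI' _).1 (factors_self I))
    have h2 := (hMs (prod.lift I.arrow (terminal.from (I : E)))).1 (by
      convert h1 using 1
      simp [prod.lift_fst_assoc, prod.lift_snd_assoc])
    rwa [prod.lift_fst] at h2

/-- Epi-mono factorizations in a topos. -/
lemma exists_epi_mono_factorization {A B : E} (f : A ⟶ B) :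
    ∃ (I : E) (e : A ⟶ I) (i : I ⟶ B), Epi e ∧ Mono i ∧ e ≫ i = f := by
  obtain ⟨I, hf, hI⟩ := exists_smallest_factors f
  refine ⟨I, I.factorThru f hf, I.arrow, ⟨fun {Z} g h w => ?_⟩, inferInstance,
    I.factorThru_arrow f hf⟩
  -- `f` factors through the equalizer of `g` and `h`, so minimality of `I` makes that equalizer all
  -- of `I`.
  have hle := hI (Subobject.mk (equalizer.ι g h ≫ I.arrow)) ((mk_factors_iff _ _).2
    ⟨equalizer.lift _ w, by simp⟩)
  have hq : ofLEMk _ _ hle ≫ equalizer.ι g h = 𝟙 _ := by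
    rw [← cancel_mono I.arrow, Category.assoc, ofLEMk_comp, Category.id_comp]
  rw [← Category.id_comp g, ← Category.id_comp h, ← hq, Category.assoc, Category.assoc,
    equalizer.condition]

/-- A subobject through which an epimorphism factors is the whole object. -/
lemma eq_top_of_factors_epi {A B : E} {U : Subobject B} (f : A ⟶ B) [Epi f] (h : U.Factors f) :
    U = ⊤ := by
  have : Epi U.arrow := epi_of_epi_fac (U.factorThru_arrow f h)
  have := isIso_of_mono_of_epi U.arrow
  exact eq_top_of_isIso_arrow U

/-- Heyting implication of subobjects, in terms of generalized elements. -/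
lemma exists_implication {X : E} (A U : Subobject X) :
    ∃ R : Subobject X, ∀ {W : E} (h : W ⟶ X), R.Factors h ↔
      ∀ {W' : E} (k : W' ⟶ W), A.Factors (k ≫ h) → U.Factors (k ≫ h) := by
  refine ⟨equalizerSubobject (χ A.arrow) (χ (A ⊓ U).arrow), fun h => ?_⟩
  rw [equalizerSubobject_factors_iff]
  constructor
  · intro e _ k hk
    rw [← trueSubobject_factors_comp_χ, Category.assoc, e, ← Category.assoc,
      trueSubobject_factors_comp_χ, inf_factors] at hk
    exact hk.2
  · intro H
    refine Ω_hom_ext fun k => ?_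
    rw [← Category.assoc, ← Category.assoc, trueSubobject_factors_comp_χ,
      trueSubobject_factors_comp_χ, inf_factors]
    exact ⟨fun hk => ⟨hk, H k hk⟩, fun hk => hk.1⟩

lemma trueSubobject_factors_comp_meet {W : E} (h : W ⟶ Ω E ⨯ Ω E) :
    (trueSubobject E).Factors (h ≫ meet E) ↔
      (trueSubobject E).Factors (h ≫ prod.fst) ∧ (trueSubobject E).Factors (h ≫ prod.snd) := by
  have e : (Subobject.pullback (meet E)).obj (trueSubobject E) =
      Subobject.mk (prod.lift (truth E) (truth E)) :=
    Subobject.Classifier.pullback_χ_obj_mk_truth _ _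
  have hfac : ∀ {V Y : E} (m : V ⟶ Y) [Mono m] (g : W ⟶ Y),
      (Subobject.mk m).Factors g ↔ ∃ k, k ≫ m = g := fun _ _ _ => Iff.rfl
  rw [← pullback_factors_iff, e, hfac, hfac, hfac]
  constructor
  · rintro ⟨k, rfl⟩
    exact ⟨⟨k, by rw [Category.assoc, prod.lift_fst]⟩, ⟨k, by rw [Category.assoc, prod.lift_snd]⟩⟩
  · rintro ⟨⟨k, hk⟩, ⟨l, hl⟩⟩
    refine ⟨k, ?_⟩
    ext
    · rw [Category.assoc, prod.lift_fst, hk]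
    · rw [← hl, Subobject.Classifier.isTerminalΩ₀.hom_ext l k, Category.assoc, prod.lift_snd]

end Topos

/-! ### Cores, and how they determine the morphism -/

namespace GoodHyperconnected

variable {E : Type u} [Category.{v} E]

lemma core_factors_iff (p : GoodHyperconnected.{u', v'} E) {W X : E} (h : W ⟶ X) :
    (p.core X).Factors h ↔ ∃ a, a ≫ p.morphism.adj.counit.app X = h :=
  Iff.rfl

lemma core_factors_counit (p : GoodHyperconnected.{u', v'} E) (X : E) :
    (p.core X).Factors (p.morphism.adj.counit.app X) :=
  (p.core_factors_iff _).2 ⟨𝟙 _, Category.id_comp _⟩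

lemma core_factors_comp (p : GoodHyperconnected.{u', v'} E) {W X Y : E} {h : W ⟶ Y} (f : Y ⟶ X)
    (H : (p.core Y).Factors h) : (p.core X).Factors (h ≫ f) := by
  obtain ⟨a, rfl⟩ := (p.core_factors_iff _).1 H
  refine (p.core_factors_iff _).2
    ⟨a ≫ p.morphism.inverseImage.map (p.morphism.directImage.map f), ?_⟩
  have := p.morphism.adj.counit.naturality f
  dsimp at this
  simp [this]

/-- Cores are monotone, hence invariant, under equivalence of geometric morphisms. -/
lemma core_le_of_equivalent {p q : GoodHyperconnected.{u', v'} E} (h : p.Equivalent q) (X : E) :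
    p.core X ≤ q.core X := by
  obtain ⟨e, ⟨i⟩⟩ := h
  refine le_of_factors ?_
  let s := p.morphism.directImage.obj X
  -- Up to isomorphism `p^* s` is in the image of `q^*`, where a triangle identity splits the
  -- counit.
  have hs : (q.core (p.morphism.inverseImage.obj s)).Factors (𝟙 _) := by
    have : (q.core (q.morphism.inverseImage.obj (e.functor.obj s))).Factors (𝟙 _) :=
      (q.core_factors_iff _).2 ⟨_, q.morphism.adj.left_triangle_components _⟩
    have h2 := factors_of_factors_right (i.inv.app s) (q.core_factors_comp (i.hom.app s) this)
    simpa using h2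
  have h3 := q.core_factors_comp (p.morphism.adj.counit.app X) hs
  obtain ⟨a, ha⟩ := (p.core_factors_iff _).1 (factors_self (p.core X))
  rw [← ha]
  rw [Category.id_comp] at h3
  exact factors_of_factors_right a h3

lemma core_eq_of_equivalent {p q : GoodHyperconnected.{u', v'} E} (h : p.Equivalent q) (X : E) :
    p.core X = q.core X :=
  le_antisymm (core_le_of_equivalent h X)
    (core_le_of_equivalent ((setoid.{u', v'} E).symm h) X)

lemma isIso_counit_iff (p : GoodHyperconnected.{u', v'} E) (X : E) :
    IsIso (p.morphism.adj.counit.app X) ↔ p.core X = ⊤ :=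
  have := p.isHyperconnected.mono_counit X
  isIso_iff_mk_eq_top _

lemma isIso_counit_inverseImage (p : GoodHyperconnected.{u', v'} E) (s : p.codomain) :
    IsIso (p.morphism.adj.counit.app (p.morphism.inverseImage.obj s)) :=
  have := p.isHyperconnected.full
  have := p.isHyperconnected.faithful
  inferInstance

/-- Cores determine a hyperconnected geometric morphism up to equivalence. -/
lemma equivalent_of_core_eq {p q : GoodHyperconnected.{u', v'} E}
    (h : ∀ X, p.core X = q.core X) : p.Equivalent q := by
  have := p.isHyperconnected.full
  have := p.isHyperconnected.faithful
  have := q.isHyperconnected.full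
  have := q.isHyperconnected.faithful
  have hp : ∀ s, IsIso (q.morphism.adj.counit.app (p.morphism.inverseImage.obj s)) := fun s =>
    (q.isIso_counit_iff _).2 (h _ ▸ (p.isIso_counit_iff _).1 (p.isIso_counit_inverseImage s))
  have hq : ∀ s, IsIso (p.morphism.adj.counit.app (q.morphism.inverseImage.obj s)) := fun s =>
    (p.isIso_counit_iff _).2 (h _ ▸ (q.isIso_counit_iff _).1 (q.isIso_counit_inverseImage s))
  let α : (p.morphism.inverseImage ⋙ q.morphism.directImage) ⋙ q.morphism.inverseImage ≅
      p.morphism.inverseImage :=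
    NatIso.ofComponents (fun s => asIso (q.morphism.adj.counit.app (p.morphism.inverseImage.obj s)))
      (fun f => q.morphism.adj.counit.naturality _)
  let β : (q.morphism.inverseImage ⋙ p.morphism.directImage) ⋙ p.morphism.inverseImage ≅
      q.morphism.inverseImage :=
    NatIso.ofComponents (fun s => asIso (p.morphism.adj.counit.app (q.morphism.inverseImage.obj s)))
      (fun f => p.morphism.adj.counit.naturality _)
  refine ⟨CategoryTheory.Equivalence.mk (p.morphism.inverseImage ⋙ q.morphism.directImage)
    (q.morphism.inverseImage ⋙ p.morphism.directImage)
    (asIso p.morphism.adj.unit ≪≫ Functor.isoWhiskerRight α.symm p.morphism.directImage)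
    (Functor.isoWhiskerRight β q.morphism.directImage ≪≫ (asIso q.morphism.adj.unit).symm), ⟨α⟩⟩

variable [ElementaryTopos E]

/-- A generalized element of a subobject `m : U ⟶ X` that lies in the core of `X` lies in the core
of `U`. -/
lemma core_factors_of_comp_mono (p : GoodHyperconnected.{u', v'} E) {W U X : E} (h : W ⟶ U)
    (m : U ⟶ X) [Mono m] (H : (p.core X).Factors (h ≫ m)) : (p.core U).Factors h := by
  obtain ⟨a, ha⟩ := (p.core_factors_iff _).1 H
  have := p.morphism.preservesFiniteLimits
  have := p.morphism.adj.rightAdjoint_preservesLimits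
  let G := p.morphism.directImage ⋙ p.morphism.inverseImage
  let ε : G ⟶ 𝟭 E := p.morphism.adj.counit
  have hε : ∀ {Y Z : E} (f : Y ⟶ Z), G.map f ≫ ε.app Z = ε.app Y ≫ f := fun f => ε.naturality f
  have : Mono (ε.app (Ω E)) := p.isHyperconnected.mono_counit (Ω E)
  have ha : a ≫ ε.app X = h ≫ m := ha
  let hG : IsTerminal (G.obj (Ω₀ E)) := Subobject.Classifier.isTerminalΩ₀.isTerminalObj G
  let b : W ⟶ G.obj (Ω₀ E) := hG.from W
  have sq := (isPullback_χ m).map G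
  -- Can be checked after the monic counit at `Ω`, where naturality reduces it to commutativity of
  -- the classifying square.
  have w : a ≫ G.map (χ m) = b ≫ G.map (truth E) := by
    rw [← cancel_mono (ε.app (Ω E)), Category.assoc, Category.assoc, hε, hε, ← Category.assoc, ha,
      Category.assoc, comm m, ← Category.assoc, ← Category.assoc]
    congr 1
    exact Subobject.Classifier.isTerminalΩ₀.hom_ext _ _
  refine (p.core_factors_iff _).2 ⟨sq.lift a b w, ?_⟩
  rw [← cancel_mono m]
  change (sq.lift a b w ≫ ε.app U) ≫ m = h ≫ m
  rw [Category.assoc, ← hε, ← Category.assoc, sq.lift_fst, ha]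

/-- If the restriction of `f : V ⟶ X` to the core of `V` factors through `U`, and `f` takes values
in the core of `X`, then `f` factors through `U`. -/
lemma factors_of_factors_core (p : GoodHyperconnected.{u', v'} E) {V X : E} (f : V ⟶ X)
    (U : Subobject X) (hf : (p.core X).Factors f)
    (hU : U.Factors (p.morphism.adj.counit.app V ≫ f)) : U.Factors f := by
  have := p.isHyperconnected.mono_counit X
  obtain ⟨a, rfl⟩ := (p.core_factors_iff _).1 hf
  obtain ⟨I, e, i, _, _, rfl⟩ := exists_epi_mono_factorization a
  have : Mono (i ≫ p.morphism.adj.counit.app X) := mono_comp _ _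
  -- The image `I` is a subobject of `X` contained in its core, so `I` is its own core.
  have hI : (p.core I).Factors (𝟙 I) := by
    refine p.core_factors_of_comp_mono (𝟙 I) (i ≫ p.morphism.adj.counit.app X) ?_
    exact (p.core_factors_iff _).2 ⟨i, by simp⟩
  obtain ⟨s, hs⟩ := (p.core_factors_iff _).1 hI
  have : IsSplitEpi (p.morphism.adj.counit.app I) := ⟨⟨⟨s, hs⟩⟩⟩
  have := p.preservesEpimorphisms
  have := p.morphism.adj.isLeftAdjoint
  have hnat := p.morphism.adj.counit.naturality e
  -- By naturality this is `p^* p_* e` followed by a split epimorphism; both `p_*` and the left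
  -- adjoint `p^*` preserve epimorphisms.
  have : Epi (p.morphism.adj.counit.app V ≫ e) := by
    have : Epi (p.morphism.inverseImage.map (p.morphism.directImage.map e) ≫
        p.morphism.adj.counit.app I) := epi_comp _ _
    exact hnat ▸ this
  have htop : (Subobject.pullback (i ≫ p.morphism.adj.counit.app X)).obj U = ⊤ := by
    refine eq_top_of_factors_epi (p.morphism.adj.counit.app V ≫ e) ?_
    rw [pullback_factors_iff]
    simpa using hU
  rw [Category.assoc, ← pullback_factors_iff, htop]
  exact top_factors e

/-! ### The topology, its closure operator and injectivity -/

/-- The map `Ω ⟶ Ω` classifying the implication from the core of `Ω` to `true`. -/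
noncomputable def classifyingMap (p : GoodHyperconnected.{u', v'} E) : Ω E ⟶ Ω E :=
  χ (exists_implication (p.core (Ω E)) (trueSubobject E)).choose.arrow

lemma trueSubobject_factors_comp_classifyingMap (p : GoodHyperconnected.{u', v'} E) {X : E}
    (φ : X ⟶ Ω E) : (trueSubobject E).Factors (φ ≫ p.classifyingMap) ↔
      (trueSubobject E).Factors (p.morphism.adj.counit.app X ≫ φ) := by
  rw [classifyingMap, trueSubobject_factors_comp_χ,
    (exists_implication (p.core (Ω E)) (trueSubobject E)).choose_spec]
  constructor
  · intro H
    exact H _ (p.core_factors_comp φ (p.core_factors_counit X))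
  · intro H W k hk
    -- It remains to test on the core of `W`, which `k` sends into the core of `X`.
    refine p.factors_of_factors_core _ _ hk ?_
    obtain ⟨a, ha⟩ := (p.core_factors_iff _).1 (p.core_factors_comp k (p.core_factors_counit W))
    rw [← Category.assoc, ← ha, Category.assoc]
    exact factors_of_factors_right a H

/-- The Lawvere–Tierney topology attached to a hyperconnected geometric morphism whose direct image
preserves epimorphisms. -/
noncomputable def topology (p : GoodHyperconnected.{u', v'} E) : LawvereTierneyTopology E where
  j := p.classifyingMap
  truth_comp := Ω_hom_ext fun h => by
    have H : ∀ {W : E} (k : W ⟶ Ω₀ E), (trueSubobject E).Factors (k ≫ truth E) := fun k =>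
      factors_of_factors_right k (mk_factors_self _)
    refine iff_of_true ?_ (H h)
    rw [← Category.assoc, trueSubobject_factors_comp_classifyingMap, ← Category.assoc]
    exact H _
  comp_self := Ω_hom_ext fun {W} h => by
    rw [← Category.assoc, trueSubobject_factors_comp_classifyingMap, ← Category.assoc,
      trueSubobject_factors_comp_classifyingMap, trueSubobject_factors_comp_classifyingMap]
    refine ⟨fun H => ?_, fun H => factors_of_factors_right _ H⟩
    -- The core of a core is everything, by the triangle identity.
    have e := p.morphism.adj.left_triangle_components_assoc (p.morphism.directImage.obj W)
      (p.morphism.adj.counit.app W ≫ h)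
    rw [← e]
    exact factors_of_factors_right _ H
  meet_comp := Ω_hom_ext fun h => by
    rw [← Category.assoc, trueSubobject_factors_comp_classifyingMap, ← Category.assoc,
      ← Category.assoc, trueSubobject_factors_comp_meet, trueSubobject_factors_comp_meet]
    simp only [Category.assoc, prod.map_fst, prod.map_snd]
    rw [← Category.assoc h, ← Category.assoc h, trueSubobject_factors_comp_classifyingMap,
      trueSubobject_factors_comp_classifyingMap]

lemma isHeytingImplication_closure (p : GoodHyperconnected.{u', v'} E) {X : E} (U : Subobject X) :
    IsHeytingImplication (p.core X) U (p.topology.closure U) := by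
  intro V
  have h1 : V ≤ p.topology.closure U ↔ (p.topology.closure U).Factors V.arrow :=
    ⟨fun h => factors_of_le _ h (factors_self V), le_of_factors⟩
  have h2 : (p.topology.closure U).Factors V.arrow ↔
      U.Factors (p.morphism.adj.counit.app (V : E) ≫ V.arrow) := by
    rw [LawvereTierneyTopology.closure, pullback_factors_iff, ← Category.assoc]
    refine (p.trueSubobject_factors_comp_classifyingMap _).trans ?_
    rw [← Category.assoc, trueSubobject_factors_comp_χ]
  rw [h1, h2]
  constructor
  · intro H
    refine le_of_factors ?_
    have hi := (inf_factors _).1 (factors_self (V ⊓ p.core X))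
    have hV := V.factorThru_arrow _ hi.1
    obtain ⟨a, ha⟩ := (p.core_factors_iff _).1
      (p.core_factors_of_comp_mono (V.factorThru _ hi.1) V.arrow (hV.symm ▸ hi.2))
    rw [← hV, ← ha, Category.assoc]
    exact factors_of_factors_right a H
  · intro H
    exact factors_of_le _ H ((inf_factors _).2
      ⟨factors_of_factors_right _ (factors_self V),
        p.core_factors_comp _ (p.core_factors_counit _)⟩)

/-- `(core X ⇒ core X) = ⊤` for `p`; reading the same closure through `q` puts its core below that
of `p`. -/
lemma core_le_of_topology_eq {p q : GoodHyperconnected.{u', v'} E} (h : p.topology = q.topology)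
    (X : E) : q.core X ≤ p.core X := by
  have h1 := (p.isHeytingImplication_closure (p.core X) ⊤).2 inf_le_right
  rw [h] at h1
  simpa using (q.isHeytingImplication_closure (p.core X) ⊤).1 h1

lemma topology_eq_of_equivalent {p q : GoodHyperconnected.{u', v'} E} (h : p.Equivalent q) :
    p.topology = q.topology := by
  refine LawvereTierneyTopology.ext (Ω_hom_ext fun {W} k => ?_)
  change (trueSubobject E).Factors (k ≫ p.classifyingMap) ↔
    (trueSubobject E).Factors (k ≫ q.classifyingMap)
  rw [trueSubobject_factors_comp_classifyingMap, trueSubobject_factors_comp_classifyingMap]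
  have key : ∀ {p q : GoodHyperconnected.{u', v'} E}, p.core W = q.core W →
      (trueSubobject E).Factors (p.morphism.adj.counit.app W ≫ k) →
      (trueSubobject E).Factors (q.morphism.adj.counit.app W ≫ k) := by
    intro p q e H
    obtain ⟨a, ha⟩ := (p.core_factors_iff _).1 (e ▸ q.core_factors_counit W)
    rw [← ha, Category.assoc]
    exact factors_of_factors_right a H
  exact ⟨key (core_eq_of_equivalent h W), key (core_eq_of_equivalent h W).symm⟩

end GoodHyperconnected

end HyperFew

theorem mainTheorem6 (E : Type u) [Category.{v} E] [HyperFew.ElementaryTopos E] :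
    ∃ Φ : Quotient (HyperFew.GoodHyperconnected.setoid.{u', v'} E) ↪
        HyperFew.LawvereTierneyTopology E,
      ∀ (p : HyperFew.GoodHyperconnected.{u', v'} E) (X : E) (U : Subobject X),
        HyperFew.IsHeytingImplication (p.core X) U
          ((Φ (Quotient.mk (HyperFew.GoodHyperconnected.setoid E) p)).closure U) := by
  refine ⟨⟨Quotient.lift HyperFew.GoodHyperconnected.topology
    fun _ _ => HyperFew.GoodHyperconnected.topology_eq_of_equivalent, ?_⟩,
    fun p _ U => p.isHeytingImplication_closure U⟩
  rintro ⟨p⟩ ⟨q⟩ h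
  exact Quotient.sound (HyperFew.GoodHyperconnected.equivalent_of_core_eq fun X =>
    le_antisymm (HyperFew.GoodHyperconnected.core_le_of_topology_eq (Eq.symm h) X)
      (HyperFew.GoodHyperconnected.core_le_of_topology_eq h X))
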